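/- For integers $m \ge 0$ and $k$, let $J_{m,k}$ denote the number of fixed-point-free involutions $\pi$ of $\{1,\ldots,m\}$ (permutations with $\pi(\pi(i)) = i$ and $\pi(i) \neq i$ for all $i$) having exactly $k$ descents, where a descent of $\pi$ is an index $i$ with $1 \le i \le m-1$ and $\pi(i) > \pi(i+1)$. In particular $J_{m,k} = 0$ for $k < 0$. Then for all integers $n \ge 2$ and $k \ge 0$, $$ 2n\,J_{2n,k} = [k(k+1)+2n-2]\,J_{2n-2,k} + 2[(k-1)(2n-k-1)+1]\,J_{2n-2,k-1} + [(2n-k)(2n-k+1)+2n-2]\,J_{2n-2,k-2}. $$ -/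

import Mathlib

/-- The set of descents of a permutation `π` of `m` linearly ordered letters: the positions `i`
(counted from `0`) such that `i + 1` is also a position and `π i > π (i + 1)`. -/
def descentSet {m : ℕ} (π : Equiv.Perm (Fin m)) : Finset (Fin m) :=
  {i : Fin m | ∃ h : (i : ℕ) + 1 < m, π ⟨(i : ℕ) + 1, h⟩ < π i}

/-- The descent number `d(π)`. -/
def descentNumber {m : ℕ} (π : Equiv.Perm (Fin m)) : ℕ :=
  (descentSet π).card

/-- The set `𝒥_m` of all fixed-point-free involutions of `m` letters. -/
def fpfInvolutions (m : ℕ) : Finset (Equiv.Perm (Fin m)) :=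
  {π : Equiv.Perm (Fin m) | (∀ i, π (π i) = i) ∧ ∀ i, π i ≠ i}

/-- `J_{m,k}`: the number of fixed-point-free involutions of `m` letters with exactly `k` descents,
for an arbitrary integer `k` (so it is `0` for negative `k`). -/
def fpfDescentCount (m : ℕ) (k : ℤ) : ℕ :=
  {π ∈ fpfInvolutions m | (descentNumber π : ℤ) = k}.card

/-! Count in two ways the pairs of a fixed-point-free involution π of 2n letters and a map f to r +
1 values such that i ↦ (f i, π i) is lexicographically increasing. For fixed π, a shift makes f
strictly increasing, which gives C(2n + r - d(π), 2n) maps (`natCard_isCompatible`). On the other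
hand the pairs (f i, f (π i)) with first entry smaller form a multiset of size n that determines π
and f, and every such multiset occurs (`natCard_compatiblePair`). Hence, for n > 0, Σ_k J_{2n,k}
C(2n + r - k, 2n) is the number of n-multisets from N = r(r+1)/2 objects. Those numbers satisfy a
one-step recurrence in n with factor N + n - 1. `choose_quadratic_identity` absorbs this factor into
binomials of lower index 2n with coefficients free of r, and comparing coefficients for all r gives
the recurrence. -/

/-! ### Compatible maps for a fixed permutation -/

theorem natCard_strictMono_fin (k N : ℕ) :
    Nat.card {g : Fin k → Fin N // StrictMono g} = N.choose k := by
  have e : {g : Fin k → Fin N // StrictMono g} ≃ (Fin k ↪o Fin N) :=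
    { toFun := fun g => OrderEmbedding.ofStrictMono g.1 g.2
      invFun := fun g => ⟨g, g.strictMono⟩
      left_inv := fun _ => rfl
      right_inv := fun _ => by ext; rfl }
  rw [Nat.card_congr (e.trans Set.powersetCard.ofFinEmbEquiv), Set.powersetCard.card,
    Nat.card_eq_fintype_card, Fintype.card_fin]

/-- The number of descents of `π` strictly before the position `i`. -/
def descentsBefore {m : ℕ} (π : Equiv.Perm (Fin m)) (i : Fin m) : ℕ :=
  {j ∈ descentSet π | j < i}.card

theorem castSucc_mem_descentSet {l : ℕ} {π : Equiv.Perm (Fin (l + 1))} {i : Fin l} :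
    i.castSucc ∈ descentSet π ↔ π i.succ < π i.castSucc := by
  have h : (i : ℕ) + 1 < l + 1 := by omega
  simp only [descentSet, Finset.mem_filter_univ, Fin.val_castSucc]
  exact ⟨fun ⟨_, h'⟩ => h', fun h' => ⟨h, h'⟩⟩

theorem descentsBefore_zero {l : ℕ} (π : Equiv.Perm (Fin (l + 1))) : descentsBefore π 0 = 0 := by
  simp [descentsBefore]

theorem descentsBefore_succ {l : ℕ} (π : Equiv.Perm (Fin (l + 1))) (i : Fin l) :
    descentsBefore π i.succ =
      descentsBefore π i.castSucc + if π i.succ < π i.castSucc then 1 else 0 := by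
  have key : {j ∈ descentSet π | j < i.succ} =
      {j ∈ descentSet π | j < i.castSucc} ∪ {j ∈ descentSet π | j = i.castSucc} := by
    ext j
    simp only [Finset.mem_filter, Finset.mem_union, ← and_or_left, Fin.ext_iff,
      Fin.lt_def, Fin.val_succ, Fin.val_castSucc, Nat.lt_succ_iff, Nat.le_iff_lt_or_eq]
  rw [descentsBefore, descentsBefore, key, Finset.card_union_of_disjoint]
  · rw [Finset.filter_eq']
    simp only [castSucc_mem_descentSet]
    split_ifs <;> simp
  · rw [Finset.disjoint_filter]
    exact fun j _ h h' => h.ne h'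

theorem descentsBefore_le {l : ℕ} (π : Equiv.Perm (Fin (l + 1))) (i : Fin (l + 1)) :
    descentsBefore π i ≤ i := by
  induction i using Fin.induction with
  | zero => simp [descentsBefore_zero]
  | succ i ih =>
    rw [descentsBefore_succ]
    simp only [Fin.val_castSucc, Fin.val_succ] at *
    split_ifs <;> omega

theorem descentsBefore_le_descentNumber {m : ℕ} (π : Equiv.Perm (Fin m)) (i : Fin m) :
    descentsBefore π i ≤ descentNumber π :=
  Finset.card_le_card (Finset.filter_subset _ _)

theorem descentsBefore_last {l : ℕ} (π : Equiv.Perm (Fin (l + 1))) :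
    descentsBefore π (Fin.last l) = descentNumber π := by
  rw [descentsBefore, descentNumber, Finset.filter_true_of_mem]
  intro j hj
  simp only [descentSet, Finset.mem_filter_univ] at hj
  obtain ⟨h, -⟩ := hj
  rw [Fin.lt_def, Fin.val_last]
  omega

/-- `f` is weakly increasing, and strictly increasing along the descents of `π`, exactly when
`i ↦ (f i, π i)` is lexicographically increasing. -/
def IsCompatible {m : ℕ} {α : Type*} [LinearOrder α] (π : Equiv.Perm (Fin m)) (f : Fin m → α) :
    Prop :=
  ∀ i j, i < j → f i < f j ∨ f i = f j ∧ π i < π j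

/-- From i to i + 1 the shift grows by 1 at an ascent and by 0 at a descent, so a weak inequality
becomes strict exactly where it is only required to be weak. -/
theorem isCompatible_iff_shift_strictMono {l : ℕ} {α : Type*} (φ : α → ℕ) [LinearOrder α]
    (hφ : StrictMono φ) (π : Equiv.Perm (Fin (l + 1))) (f : Fin (l + 1) → α) :
    IsCompatible π f ↔ StrictMono fun i => φ (f i) + ((i : ℕ) - descentsBefore π i) := by
  have h1 : IsCompatible π f ↔ StrictMono fun i => toLex (f i, π i) := by
    simp only [IsCompatible, StrictMono, Prod.Lex.toLex_lt_toLex]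
  rw [h1, Fin.strictMono_iff_lt_succ, Fin.strictMono_iff_lt_succ]
  refine forall_congr' fun i => ?_
  have hle := descentsBefore_le π i.castSucc
  have hne : π i.castSucc ≠ π i.succ := π.injective.ne (Fin.castSucc_lt_succ).ne
  rw [Prod.Lex.toLex_lt_toLex, descentsBefore_succ, ← hφ.lt_iff_lt, ← hφ.injective.eq_iff]
  simp only [Fin.val_castSucc, Fin.val_succ] at *
  rcases lt_or_gt_of_ne hne with h | h
  · simp only [h, not_lt_of_gt h, if_false, and_true]
    omega
  · simp only [h, not_lt_of_gt h, if_true, and_false, or_false]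
    omega

theorem StrictMono.val_sub_le_fin {l : ℕ} {g : Fin (l + 1) → ℕ} (hg : StrictMono g)
    (i : Fin (l + 1)) : (i : ℕ) ≤ g i ∧ g i + (l - i) ≤ g (Fin.last l) := by
  constructor
  · induction i using Fin.induction with
    | zero => simp
    | succ i ih =>
      have := hg (Fin.castSucc_lt_succ (i := i))
      simp only [Fin.val_castSucc, Fin.val_succ] at *
      omega
  · induction i using Fin.reverseInduction with
    | last => simp
    | cast i ih =>
      have := hg (Fin.castSucc_lt_succ (i := i))
      simp only [Fin.val_castSucc, Fin.val_succ] at *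
      omega

theorem natCard_isCompatible {l : ℕ} (π : Equiv.Perm (Fin (l + 1))) (r : ℕ) :
    Nat.card {f : Fin (l + 1) → Fin (r + 1) // IsCompatible π f} =
      (l + 1 + r - descentNumber π).choose (l + 1) := by
  have hd : descentNumber π ≤ l := by
    simpa [descentsBefore_last] using descentsBefore_le π (Fin.last l)
  rw [← natCard_strictMono_fin]
  have key := isCompatible_iff_shift_strictMono (α := Fin (r + 1)) (fun a => (a : ℕ))
    (fun _ _ h => h) π
  -- Since `i ≤ g i`, undoing the shift never truncates; counting back from the last value of `g`
  -- keeps the result at most `r`.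
  have bound {g : Fin (l + 1) → Fin (l + 1 + r - descentNumber π)} (hg : StrictMono g)
      (i : Fin (l + 1)) : (i : ℕ) ≤ g i ∧ (g i : ℕ) - ((i : ℕ) - descentsBefore π i) < r + 1 := by
    have h := StrictMono.val_sub_le_fin (g := fun i => (g i : ℕ)) (fun _ _ h => hg h) i
    have h' := StrictMono.val_sub_le_fin (g := fun i => (g i : ℕ)) (fun _ _ h => hg h) (Fin.last l)
    have h1 := (g (Fin.last l)).2
    have h2 := descentsBefore_le_descentNumber π i
    have h3 := descentsBefore_le π i
    have h4 := i.2
    simp only [Fin.val_last] at h'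
    omega
  refine Nat.card_congr
    { toFun := fun f => ⟨fun i => ⟨f.1 i + ((i : ℕ) - descentsBefore π i), ?_⟩, ?_⟩
      invFun := fun g => ⟨fun i => ⟨g.1 i - ((i : ℕ) - descentsBefore π i), (bound g.2 i).2⟩, ?_⟩
      left_inv := fun f => ?_
      right_inv := fun g => ?_ }
  · have h := (((key f.1).1 f.2).val_sub_le_fin i).2
    have h1 := (f.1 (Fin.last l)).2
    simp only [descentsBefore_last, Fin.val_last] at h
    omega
  · exact fun i j hij => (key f.1).1 f.2 hij
  · rw [key]
    intro i j hij
    have := g.2 hij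
    have h1 := (bound g.2 i).1
    have h2 := (bound g.2 j).1
    simp only [Fin.lt_def] at this ⊢
    omega
  · ext i
    simp
  · ext i
    have := (bound g.2 i).1
    simp only
    omega

/-! ### Compatible pairs as multisets of ordered pairs -/

theorem eq_of_monotone_of_map_univ_eq {m : ℕ} {α : Type*} [PartialOrder α] {g h : Fin m → α}
    (hg : Monotone g) (hh : Monotone h)
    (e : (Finset.univ : Finset (Fin m)).val.map g = (Finset.univ : Finset (Fin m)).val.map h) :
    g = h := by
  rw [Fin.univ_val_map, Fin.univ_val_map, Multiset.coe_eq_coe] at e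
  exact List.ofFn_injective
    (e.eq_of_pairwise' hg.sortedLE_ofFn.pairwise hh.sortedLE_ofFn.pairwise)

theorem exists_monotone_map_univ_eq {m : ℕ} {α : Type*} [LinearOrder α] (D : Multiset α)
    (hD : D.card = m) :
    ∃ g : Fin m → α, Monotone g ∧ (Finset.univ : Finset (Fin m)).val.map g = D := by
  subst hD
  have hl : (D.sort (· ≤ ·)).length = D.card := by simp
  refine ⟨fun i => (D.sort (· ≤ ·)).get (i.cast hl.symm), ?_, ?_⟩
  · intro i j hij
    exact (D.pairwise_sort (· ≤ ·)).sortedLE.monotone_get (by simpa using hij)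
  · rw [Fin.univ_val_map]
    conv_rhs => rw [← Multiset.sort_eq D (· ≤ ·)]
    congr 1
    apply List.ext_get <;> simp

theorem mem_fpfInvolutions {m : ℕ} {π : Equiv.Perm (Fin m)} :
    π ∈ fpfInvolutions m ↔ (∀ i, π (π i) = i) ∧ ∀ i, π i ≠ i := by
  simp [fpfInvolutions]

/-- The multiset of the pairs `(f i, f (π i))`. -/
def pairMultiset {m : ℕ} {α : Type*} (π : Equiv.Perm (Fin m)) (f : Fin m → α) : Multiset (α × α) :=
  (Finset.univ : Finset (Fin m)).val.map fun i => (f i, f (π i))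

theorem pairMultiset_map_swap {m : ℕ} {α : Type*} {π : Equiv.Perm (Fin m)} (hπ : π ∈ fpfInvolutions m)
    (f : Fin m → α) : (pairMultiset π f).map Prod.swap = pairMultiset π f := by
  rw [mem_fpfInvolutions] at hπ
  rw [pairMultiset, Multiset.map_map]
  conv_rhs => rw [← Multiset.map_univ_val_equiv π, Multiset.map_map]
  simp [hπ.1]

section Pairs

variable {m : ℕ} {α : Type*} [LinearOrder α]

/-- The fixed-point-free involutions of `m` letters together with a compatible map to `α`. -/
def CompatiblePair (m : ℕ) (α : Type*) [LinearOrder α] : Type _ :=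
  {x : Equiv.Perm (Fin m) × (Fin m → α) // x.1 ∈ fpfInvolutions m ∧ IsCompatible x.1 x.2}

theorem IsCompatible.monotone {π : Equiv.Perm (Fin m)} {f : Fin m → α} (h : IsCompatible π f) :
    Monotone f := by
  intro i j hij
  rcases hij.eq_or_lt with rfl | hij
  · rfl
  · exact (h i j hij).elim le_of_lt fun h => h.1.le

/-- Equality would force π to be increasing on `{i, π i}`, whose two elements it exchanges. -/
theorem IsCompatible.apply_ne {π : Equiv.Perm (Fin m)} {f : Fin m → α} (h : IsCompatible π f)
    (hπ : π ∈ fpfInvolutions m) (i : Fin m) : f i ≠ f (π i) := by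
  rw [mem_fpfInvolutions] at hπ
  intro e
  rcases lt_or_gt_of_ne (hπ.2 i) with hlt | hlt
  · have := h _ _ hlt
    simp only [e, lt_irrefl, true_and, false_or, hπ.1] at this
    exact lt_asymm this hlt
  · have := h _ _ hlt
    simp only [e, lt_irrefl, true_and, false_or, hπ.1] at this
    exact lt_asymm this hlt

theorem filter_lt_add_map_swap {D : Multiset (α × α)} (hD : D.map Prod.swap = D)
    (hne : ∀ p ∈ D, p.1 ≠ p.2) :
    D.filter (fun p => p.1 < p.2) + (D.filter fun p => p.1 < p.2).map Prod.swap = D := by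
  have h : (D.filter fun p => p.1 < p.2).map Prod.swap = D.filter fun p => ¬ p.1 < p.2 := by
    conv_rhs => rw [← hD, Multiset.filter_map]
    congr 1
    apply Multiset.filter_congr
    intro p hp
    have := hne p hp
    simp only [Function.comp, Prod.fst_swap, Prod.snd_swap, not_lt]
    exact ⟨le_of_lt, fun h => lt_of_le_of_ne h this⟩
  rw [h, Multiset.filter_add_not]

theorem filter_lt_of_add_map_swap {E : Multiset (α × α)} (hE : ∀ p ∈ E, p.1 < p.2) :
    (E + E.map Prod.swap).filter (fun p => p.1 < p.2) = E := by
  rw [Multiset.filter_add, Multiset.filter_eq_self.2 hE, Multiset.filter_eq_nil.2, add_zero]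
  simp only [Multiset.mem_map, forall_exists_index, and_imp, forall_apply_eq_imp_iff₂]
  exact fun p hp => not_lt_of_gt (hE p hp)

theorem pairMultiset_ne {π : Equiv.Perm (Fin m)} {f : Fin m → α} (h : IsCompatible π f)
    (hπ : π ∈ fpfInvolutions m) : ∀ p ∈ pairMultiset π f, p.1 ≠ p.2 := by
  simp only [pairMultiset, Multiset.mem_map, forall_exists_index, and_imp,
    forall_apply_eq_imp_iff₂]
  exact fun i _ => h.apply_ne hπ i

theorem IsCompatible.monotone_toLex {π : Equiv.Perm (Fin m)} {f : Fin m → α}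
    (h : IsCompatible π f) : Monotone fun i => toLex (f i, f (π i)) := by
  intro i j hij
  rcases hij.eq_or_lt with rfl | hij
  · rfl
  · rw [Prod.Lex.toLex_le_toLex]
    exact (h i j hij).imp id fun h' => ⟨h'.1, h.monotone h'.2.le⟩

/-- Composing the key with π gives the increasing sequence `(f i, f (π i))`, and compatibility
breaks ties as a stable sort does. Thus this sequence determines π. -/
theorem IsCompatible.eq_sort {π : Equiv.Perm (Fin m)} {f : Fin m → α} (h : IsCompatible π f)
    (hπ : π ∈ fpfInvolutions m) : π = Tuple.sort fun i => toLex (f (π i), f i) := by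
  rw [mem_fpfInvolutions] at hπ
  rw [Tuple.eq_sort_iff]
  simp only [Function.comp_def, hπ.1]
  refine ⟨h.monotone_toLex, fun i j hij e => ?_⟩
  have e' : f i = f j := congrArg (fun x => (ofLex x).1) e
  exact ((h i j hij).resolve_left e'.not_lt).2

theorem eq_of_filter_pairMultiset_eq {π σ : Equiv.Perm (Fin m)} {f g : Fin m → α}
    (hπ : π ∈ fpfInvolutions m) (hσ : σ ∈ fpfInvolutions m)
    (hf : IsCompatible π f) (hg : IsCompatible σ g)
    (e : (pairMultiset π f).filter (fun p => p.1 < p.2) =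
      (pairMultiset σ g).filter fun p => p.1 < p.2) : π = σ ∧ f = g := by
  have e1 : pairMultiset π f = pairMultiset σ g := by
    rw [← filter_lt_add_map_swap (pairMultiset_map_swap hπ f) (pairMultiset_ne hf hπ), e,
      filter_lt_add_map_swap (pairMultiset_map_swap hσ g) (pairMultiset_ne hg hσ)]
  have e2 := eq_of_monotone_of_map_univ_eq hf.monotone_toLex hg.monotone_toLex (by
    have := congrArg (Multiset.map toLex) e1
    simp only [pairMultiset, Multiset.map_map] at this
    exact this)
  have e3 : f = g := funext fun i => congrArg (fun x => (ofLex x).1) (congrFun e2 i)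
  have e4 (i) : f (π i) = g (σ i) := congrArg (fun x => (ofLex x).2) (congrFun e2 i)
  refine ⟨?_, e3⟩
  rw [hf.eq_sort hπ, hg.eq_sort hσ]
  congr 1
  funext i
  rw [e4, e3]

/-- List `D` in lexicographic order as `g` and let π stably sort the swapped list. Symmetry of `D`
makes the sorted result `g` again, so π realises the swap. -/
theorem exists_compatible_pairMultiset_eq (D : Multiset (α × α)) (hD : D.card = m)
    (hs : D.map Prod.swap = D) (hne : ∀ p ∈ D, p.1 ≠ p.2) :
    ∃ (π : Equiv.Perm (Fin m)) (f : Fin m → α), π ∈ fpfInvolutions m ∧ IsCompatible π f ∧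
      pairMultiset π f = D := by
  obtain ⟨g, hg, hgD⟩ := exists_monotone_map_univ_eq (m := m) (D.map toLex) (by simpa)
  set s : α ×ₗ α → α ×ₗ α := fun p => toLex (ofLex p).swap with hs_def
  have hss (p) : s (s p) = p := rfl
  obtain ⟨π, hπ⟩ : ∃ π, π = Tuple.sort (s ∘ g) := ⟨_, rfl⟩
  obtain ⟨hπ1, hπ2⟩ := Tuple.eq_sort_iff.1 hπ
  have hcomp : (s ∘ g) ∘ π = g := by
    apply eq_of_monotone_of_map_univ_eq hπ1 hg
    rw [← Multiset.map_map, Multiset.map_univ_val_equiv, ← Multiset.map_map, hgD,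
      Multiset.map_map]
    conv_rhs => rw [← hs, Multiset.map_map]
    rfl
  have hgπ (i) : g (π i) = s (g i) := by
    rw [← hss (g (π i))]
    exact congrArg s (congrFun hcomp i)
  have hinv (i) : π (π i) = i := by
    have h1 : Monotone (g ∘ (π * π)) := by
      have : g ∘ (π * π) = g := by
        funext i
        simp [hgπ, hss]
      rwa [this]
    -- π preserves the order within ties of `g`, hence so does its square, which is therefore the
    -- stable sort of a sorted list: the identity.
    have h2 : π * π = Tuple.sort g := by
      refine Tuple.eq_sort_iff.2 ⟨h1, fun i j hij e => ?_⟩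
      simp only [Equiv.Perm.mul_apply, hgπ, hss] at e ⊢
      have hlt : π i < π j := hπ2 i j hij (by simp [hgπ, hss, e])
      exact hπ2 _ _ hlt (by simp [hgπ, hss, e])
    rw [Tuple.sort_eq_refl_iff_monotone.2 hg] at h2
    exact congrArg (fun σ : Equiv.Perm (Fin m) => σ i) h2
  have hmem (i) : ofLex (g i) ∈ D := by
    have : g i ∈ D.map toLex := hgD ▸ Multiset.mem_map_of_mem g (Finset.mem_univ i)
    obtain ⟨p, hp, e⟩ := Multiset.mem_map.1 this
    rw [← e]
    exact hp
  have hfst (i) : (ofLex (g (π i))).1 = (ofLex (g i)).2 := by rw [hgπ]; rfl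
  refine ⟨π, fun i => (ofLex (g i)).1, mem_fpfInvolutions.2 ⟨hinv, fun i e => ?_⟩,
    fun i j hij => ?_, ?_⟩
  · have := hfst i
    rw [e] at this
    exact hne _ (hmem i) this
  · have hfm : Monotone fun i => (ofLex (g i)).1 := fun i j hij => by
      rcases Prod.Lex.le_iff.1 (hg hij) with h | h
      · exact h.le
      · exact h.1.le
    rcases Prod.Lex.le_iff.1 (hg hij.le) with h | ⟨h, h'⟩
    · exact Or.inl h
    · refine Or.inr ⟨h, ?_⟩
      rcases h'.eq_or_lt with h' | h'
      · have : g i = g j := ofLex.injective (Prod.ext h h')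
        exact hπ2 i j hij (by simp [hgπ, this])
      · rw [← hfst, ← hfst] at h'
        exact hfm.reflect_lt h'
  · simp only [pairMultiset, hfst]
    have := congrArg (Multiset.map ofLex) hgD
    simpa [Multiset.map_map, Function.comp_def] using this

/-- Both sides embed in the multisets on `α × α` with the same image: the n-element multisets lying
strictly above the diagonal. -/
theorem natCard_compatiblePair (n : ℕ) (α : Type*) [LinearOrder α] [Fintype α] :
    Nat.card (CompatiblePair (2 * n) α) =
      (Fintype.card {p : α × α // p.1 < p.2}).multichoose n := by
  classical
  let Φ : CompatiblePair (2 * n) α → Multiset (α × α) := fun x =>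
    (pairMultiset x.1.1 x.1.2).filter fun p => p.1 < p.2
  let Θ : Sym {p : α × α // p.1 < p.2} n → Multiset (α × α) := fun s => s.1.map Subtype.val
  have hΦ : Function.Injective Φ := fun x y e => by
    obtain ⟨h1, h2⟩ := eq_of_filter_pairMultiset_eq x.2.1 y.2.1 x.2.2 y.2.2 e
    exact Subtype.ext (Prod.ext h1 h2)
  have hΘ : Function.Injective Θ := fun s t e =>
    Subtype.ext (Multiset.map_injective Subtype.val_injective e)
  have hr : Set.range Φ = Set.range Θ := by
    ext E
    constructor
    · rintro ⟨x, rfl⟩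
      have hlt : ∀ p ∈ Φ x, p.1 < p.2 := fun p hp => (Multiset.mem_filter.1 hp).2
      have hc : (Φ x).card = n := by
        have := congrArg Multiset.card (filter_lt_add_map_swap
          (pairMultiset_map_swap x.2.1 x.1.2) (pairMultiset_ne x.2.2 x.2.1))
        simp only [Multiset.card_add, Multiset.card_map, pairMultiset, Finset.card_val,
          Finset.card_univ, Fintype.card_fin] at this
        simp only [Φ, pairMultiset]
        omega
      refine ⟨⟨(Φ x).pmap Subtype.mk hlt, by simpa using hc⟩, ?_⟩
      simp [Θ, Multiset.map_pmap, Multiset.pmap_eq_map]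
    · rintro ⟨s, rfl⟩
      have hlt : ∀ p ∈ Θ s, p.1 < p.2 := by
        simp only [Θ, Multiset.mem_map, forall_exists_index, and_imp, forall_apply_eq_imp_iff₂]
        exact fun p _ => p.2
      obtain ⟨π, f, h1, h2, h3⟩ := exists_compatible_pairMultiset_eq (m := 2 * n)
        (Θ s + (Θ s).map Prod.swap) (by
          have : s.1.card = n := s.2
          simp only [Θ, Multiset.card_add, Multiset.card_map, this]
          omega)
        (by simp [Multiset.map_map, add_comm])
        (by
          intro p hp
          rcases Multiset.mem_add.1 hp with hp | hp
          · exact (hlt p hp).ne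
          · obtain ⟨q, hq, rfl⟩ := Multiset.mem_map.1 hp
            exact (hlt q hq).ne')
      exact ⟨⟨(π, f), h1, h2⟩, by simp only [Φ, h3, filter_lt_of_add_map_swap hlt]⟩
  rw [← Nat.card_range_of_injective hΦ, hr, Nat.card_range_of_injective hΘ,
    Nat.card_eq_fintype_card, Sym.card_sym_eq_multichoose]

end Pairs

/-! ### The counting identity for descent numbers -/

theorem two_mul_card_lt_pairs (α : Type*) [LinearOrder α] [Fintype α] :
    2 * Fintype.card {p : α × α // p.1 < p.2} = Fintype.card α * (Fintype.card α - 1) := by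
  have h1 : (Finset.univ.filter fun p : α × α => p.1 < p.2).card =
      (Finset.univ.filter fun p : α × α => p.2 < p.1).card :=
    Finset.card_equiv (Equiv.prodComm α α) (by simp)
  have h2 : (Finset.univ : Finset α).offDiag =
      (Finset.univ.filter fun p : α × α => p.1 < p.2) ∪
        Finset.univ.filter fun p : α × α => p.2 < p.1 := by
    ext p
    simp
  have h3 := congrArg Finset.card h2
  rw [Finset.card_union_of_disjoint, ← h1, Finset.offDiag_card, Finset.card_univ] at h3
  · rw [Fintype.card_subtype, Nat.mul_sub, mul_one, h3, two_mul]
  · rw [Finset.disjoint_filter]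
    exact fun p _ h => h.asymm

theorem succ_mul_multichoose_succ (c n : ℕ) :
    (n + 1) * c.multichoose (n + 1) = (c + n) * c.multichoose n := by
  rw [Nat.multichoose_eq, Nat.multichoose_eq]
  rcases c with _ | c
  · rcases n with _ | n <;> simp
  · have := Nat.add_one_mul_choose_eq (c + n) n
    rw [show c + 1 + (n + 1) - 1 = c + n + 1 by omega, show c + 1 + n - 1 = c + n by omega,
      mul_comm, ← this]
    ring

theorem sum_choose_descentNumber (n r : ℕ) (hn : 0 < n) :
    ∑ π ∈ fpfInvolutions (2 * n), (2 * n + r - descentNumber π).choose (2 * n) =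
      (Fintype.card {p : Fin (r + 1) × Fin (r + 1) // p.1 < p.2}).multichoose n := by
  obtain ⟨l, hl⟩ : ∃ l, 2 * n = l + 1 := ⟨2 * n - 1, by omega⟩
  have e : CompatiblePair (2 * n) (Fin (r + 1)) ≃
      Σ π : fpfInvolutions (2 * n), {f : Fin (2 * n) → Fin (r + 1) // IsCompatible π.1 f} :=
    { toFun := fun x => ⟨⟨x.1.1, x.2.1⟩, x.1.2, x.2.2⟩
      invFun := fun y => ⟨(y.1.1, y.2.1), y.1.2, y.2.2⟩
      left_inv := fun _ => rfl
      right_inv := fun _ => rfl }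
  rw [← natCard_compatiblePair, Nat.card_congr e, Nat.card_sigma,
    ← Finset.sum_coe_sort]
  refine Finset.sum_congr rfl fun π _ => ?_
  generalize π.1 = σ
  revert σ
  rw [hl]
  exact fun σ => (natCard_isCompatible σ r).symm

theorem fpfDescentCount_of_neg {m : ℕ} {k : ℤ} (hk : k < 0) : fpfDescentCount m k = 0 := by
  rw [fpfDescentCount, Finset.card_eq_zero, Finset.filter_eq_empty_iff]
  intro π _
  omega

theorem sum_fpfDescentCount_mul_choose (n r : ℕ) (hn : 0 < n) :
    ∑ k ∈ Finset.range (r + 1), fpfDescentCount (2 * n) k * (2 * n + (r - k)).choose (2 * n) =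
      (Fintype.card {p : Fin (r + 1) × Fin (r + 1) // p.1 < p.2}).multichoose n := by
  rw [← sum_choose_descentNumber n r hn]
  have h1 : ∑ π ∈ fpfInvolutions (2 * n), (2 * n + r - descentNumber π).choose (2 * n) =
      ∑ π ∈ fpfInvolutions (2 * n) with descentNumber π ∈ Finset.range (r + 1),
        (2 * n + r - descentNumber π).choose (2 * n) := by
    rw [Finset.sum_filter]
    refine Finset.sum_congr rfl fun π _ => ?_
    split_ifs with h
    · rfl
    · rw [Finset.mem_range] at h
      -- More than `r` descents leave an upper index below `2 * n`, also when the subtraction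
      -- truncates, because `n` is positive.
      exact Nat.choose_eq_zero_of_lt (by omega)
  rw [h1, ← Finset.sum_fiberwise_of_maps_to (g := descentNumber) (t := Finset.range (r + 1))
    (fun π hπ => (Finset.mem_filter.1 hπ).2)]
  refine Finset.sum_congr rfl fun k hk => ?_
  have hkr := Finset.mem_range.1 hk
  have h2 : fpfDescentCount (2 * n) k = {π ∈ {π ∈ fpfInvolutions (2 * n) |
      descentNumber π ∈ Finset.range (r + 1)} | descentNumber π = k}.card := by
    rw [fpfDescentCount, Finset.filter_filter]
    congr 1
    refine Finset.filter_congr fun π _ => ?_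
    rw [Nat.cast_inj]
    exact ⟨fun h => ⟨h ▸ hk, h⟩, fun h => h.2⟩
  rw [h2, ← smul_eq_mul, ← Finset.sum_const]
  refine Finset.sum_congr rfl fun π hπ => ?_
  rw [(Finset.mem_filter.1 hπ).2, Nat.add_sub_assoc (by omega)]

/-! ### Binomial identity and comparison of coefficients -/

/-- After multiplication by (m+1)(m+2) every binomial is a polynomial multiple of C(m+s, m), leaving
a polynomial identity. -/
theorem choose_quadratic_identity (m k s : ℕ) :
    (((k : ℤ) + s) * (k + s + 1) + m) * (m + s).choose m =
      ((k : ℤ) * (k + 1) + m) * (m + 2 + s).choose (m + 2)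
        + 2 * ((k : ℤ) * (m - k) + 1) * (m + 1 + s).choose (m + 2)
        + (((m : ℤ) - k) * (m - k + 1) + m) * (m + s).choose (m + 2) := by
  have h1 : ((m + s).choose (m + 1) : ℤ) * (m + 1) = (m + s).choose m * s := by
    have := Nat.choose_succ_right_eq (m + s) m
    rw [Nat.add_sub_cancel_left] at this
    exact_mod_cast this
  have h2 : ((m + s).choose (m + 2) : ℤ) * (m + 2) = (m + s).choose (m + 1) * (s - 1) := by
    have := Nat.choose_succ_right_eq (m + s) (m + 1)
    -- At `s = 0` the natural subtraction differs from `s - 1`, but the binomial beside it vanishes.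
    rcases s with _ | s
    · simp [Nat.choose_eq_zero_of_lt]
    · rw [show m + (s + 1) - (m + 1) = s by omega] at this
      push_cast
      rw [add_sub_cancel_right]
      exact_mod_cast this
  have h3 : ((m : ℤ) + s + 1) * (m + s).choose (m + 1) =
      (m + 1 + s).choose (m + 2) * (m + 2) := by
    have := Nat.add_one_mul_choose_eq (m + s) (m + 1)
    rw [show m + 1 + s = m + s + 1 by omega]
    exact_mod_cast this
  have h4 : ((m : ℤ) + s + 1) * (m + s).choose m = (m + 1 + s).choose (m + 1) * (m + 1) := by
    have := Nat.add_one_mul_choose_eq (m + s) m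
    rw [show m + 1 + s = m + s + 1 by omega]
    exact_mod_cast this
  have h5 : ((m : ℤ) + s + 2) * (m + 1 + s).choose (m + 1) =
      (m + 2 + s).choose (m + 2) * (m + 2) := by
    have := Nat.add_one_mul_choose_eq (m + 1 + s) (m + 1)
    rw [show m + 2 + s = m + 1 + s + 1 by omega, show (m : ℤ) + s + 2 = m + 1 + s + 1 by ring]
    exact_mod_cast this
  have hm : ((m : ℤ) + 1) * (m + 2) ≠ 0 := by positivity
  apply mul_left_cancel₀ hm
  generalize ((m + s).choose m : ℤ) = c at *
  generalize ((m + s).choose (m + 1) : ℤ) = c1 at *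
  generalize ((m + s).choose (m + 2) : ℤ) = c2 at *
  generalize ((m + 1 + s).choose (m + 1) : ℤ) = d1 at *
  generalize ((m + 1 + s).choose (m + 2) : ℤ) = d2 at *
  generalize ((m + 2 + s).choose (m + 2) : ℤ) = e2 at *
  have he : ((m : ℤ) + 1) * (m + 2) * e2 = (m + s + 2) * (m + s + 1) * c := by
    linear_combination (-(m : ℤ) - 1) * h5 - (m + s + 2) * h4
  have hd : ((m : ℤ) + 1) * (m + 2) * d2 = (m + s + 1) * s * c := by
    linear_combination (-(m : ℤ) - 1) * h3 + (m + s + 1) * h1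
  have hc : ((m : ℤ) + 1) * (m + 2) * c2 = s * (s - 1) * c := by
    linear_combination ((m : ℤ) + 1) * h2 + (s - 1) * h1
  linear_combination (-(k * (k + 1) + m : ℤ)) * he - (2 * (k * (m - k) + 1) : ℤ) * hd
    - ((m - k) * (m - k + 1) + m : ℤ) * hc

theorem sum_shift_mul (F : ℤ → ℤ) (hF : F (-1) = 0) (c c' : ℕ → ℤ) (h0 : c' 0 = 0)
    (hs : ∀ s, c' (s + 1) = c s) (r : ℕ) :
    ∑ k ∈ Finset.range (r + 1), F (k - 1) * c (r - k) =
      ∑ k ∈ Finset.range (r + 1), F k * c' (r - k) := by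
  rw [Finset.sum_range_succ', Finset.sum_range_succ]
  simp only [Nat.cast_zero, zero_sub, hF, zero_mul, Nat.sub_self, h0, mul_zero, add_zero,
    Nat.cast_add, Nat.cast_one, add_sub_cancel_right]
  refine Finset.sum_congr rfl fun k hk => ?_
  have := Finset.mem_range.1 hk
  rw [← hs, show r - (k + 1) + 1 = r - k by omega]

/-- The system is triangular with diagonal entry `c 0 = 1`. -/
theorem eq_of_forall_sum_mul_eq {x y : ℕ → ℤ} {c : ℕ → ℤ} (hc : c 0 = 1)
    (h : ∀ r, ∑ k ∈ Finset.range (r + 1), x k * c (r - k) =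
      ∑ k ∈ Finset.range (r + 1), y k * c (r - k)) (k : ℕ) : x k = y k := by
  induction k using Nat.strong_induction_on with
  | _ r ih =>
    have := h r
    rw [Finset.sum_range_succ, Finset.sum_range_succ,
      Finset.sum_congr rfl fun k hk => by rw [ih k (Finset.mem_range.1 hk)]] at this
    simpa [hc] using this

theorem mainTheorem4 (n : ℕ) (hn : 2 ≤ n) (k : ℤ) (hk : 0 ≤ k) :
    2 * (n : ℤ) * (fpfDescentCount (2 * n) k : ℤ) =
      (k * (k + 1) + 2 * (n : ℤ) - 2) * (fpfDescentCount (2 * n - 2) k : ℤ)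
      + 2 * ((k - 1) * (2 * (n : ℤ) - k - 1) + 1) * (fpfDescentCount (2 * n - 2) (k - 1) : ℤ)
      + ((2 * (n : ℤ) - k) * (2 * (n : ℤ) - k + 1) + 2 * (n : ℤ) - 2)
        * (fpfDescentCount (2 * n - 2) (k - 2) : ℤ) := by
  lift k to ℕ using hk
  obtain ⟨p, rfl⟩ : ∃ p, n = p + 1 := ⟨n - 1, by omega⟩
  have hp : 0 < p := by omega
  rw [show 2 * (p + 1) - 2 = 2 * p by omega]
  set b : ℤ → ℤ := fun j => fpfDescentCount (2 * p) j with hb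
  have hbneg {j : ℤ} (hj : j < 0) : b j = 0 := by simp [hb, fpfDescentCount_of_neg hj]
  set c : ℕ → ℤ := fun s => (2 * p + 2 + s).choose (2 * p + 2) with hc
  set c1 : ℕ → ℤ := fun s => (2 * p + 1 + s).choose (2 * p + 2) with hc1
  set c2 : ℕ → ℤ := fun s => (2 * p + s).choose (2 * p + 2) with hc2
  refine eq_of_forall_sum_mul_eq (c := c)
    (x := fun k => 2 * ((p + 1 : ℕ) : ℤ) * fpfDescentCount (2 * (p + 1)) k)
    (y := fun k => (k * (k + 1) + 2 * ((p + 1 : ℕ) : ℤ) - 2) * b k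
      + 2 * ((k - 1) * (2 * ((p + 1 : ℕ) : ℤ) - k - 1) + 1) * b (k - 1)
      + ((2 * ((p + 1 : ℕ) : ℤ) - k) * (2 * ((p + 1 : ℕ) : ℤ) - k + 1)
        + 2 * ((p + 1 : ℕ) : ℤ) - 2) * b (k - 2)) (by simp [hc]) (fun r => ?_) k
  set N := Fintype.card {q : Fin (r + 1) × Fin (r + 1) // q.1 < q.2} with hN
  have hNr : 2 * (N : ℤ) = (r + 1) * r := by
    have := two_mul_card_lt_pairs (Fin (r + 1))
    rw [Fintype.card_fin, Nat.add_sub_cancel] at this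
    exact_mod_cast this
  have hA : ∑ k ∈ Finset.range (r + 1), (fpfDescentCount (2 * (p + 1)) k : ℤ) * c (r - k) =
      N.multichoose (p + 1) := by
    rw [hN, ← sum_fpfDescentCount_mul_choose (p + 1) r (by omega)]
    push_cast
    rfl
  have hB : ∑ k ∈ Finset.range (r + 1), b k * (2 * p + (r - k)).choose (2 * p) =
      (N.multichoose p : ℤ) := by
    rw [hN, ← sum_fpfDescentCount_mul_choose p r hp]
    push_cast
    rfl
  have hM : ((p : ℤ) + 1) * N.multichoose (p + 1) = (N + p) * N.multichoose p := by
    exact_mod_cast succ_mul_multichoose_succ N p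
  have hc1s (s) : c1 (s + 1) = c s := by
    simp only [hc, hc1]
    rw [show 2 * p + 1 + (s + 1) = 2 * p + 2 + s by omega]
  have hc2s (s) : c2 (s + 1) = c1 s := by
    simp only [hc1, hc2]
    rw [show 2 * p + (s + 1) = 2 * p + 1 + s by omega]
  have hc10 : c1 0 = 0 := by simp [hc1]
  have hc20 : c2 0 = 0 := by simp [hc2, Nat.choose_eq_zero_of_lt]
  have hS1 := sum_shift_mul (fun j => 2 * (j * (2 * p - j) + 1) * b j)
    (by simp [hbneg]) c c1 hc10 hc1s r
  -- The `b (k - 2)` term needs two shifts, from `c` to `c1` and then to `c2`.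
  have hS2 := sum_shift_mul (fun j => ((2 * p - (j - 1)) * (2 * p - (j - 1) + 1) + 2 * p)
    * b (j - 1)) (by simp [hbneg]) c c1 hc10 hc1s r
  rw [sum_shift_mul (fun j => ((2 * p - j) * (2 * p - j + 1) + 2 * p) * b j)
    (by simp [hbneg]) c1 c2 hc20 hc2s r] at hS2
  calc
    _ = 2 * (((p : ℤ) + 1) * N.multichoose (p + 1)) := by
      rw [← hA, Finset.mul_sum, Finset.mul_sum]
      refine Finset.sum_congr rfl fun k _ => ?_
      push_cast
      ring
    _ = ((r : ℤ) * (r + 1) + 2 * p) * N.multichoose p := by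
      rw [hM]
      linear_combination (N.multichoose p : ℤ) * hNr
    _ = ∑ k ∈ Finset.range (r + 1), (((k : ℤ) * (k + 1) + 2 * p) * b k * c (r - k)
          + 2 * ((k : ℤ) * (2 * p - k) + 1) * b k * c1 (r - k)
          + ((2 * p - (k : ℤ)) * (2 * p - k + 1) + 2 * p) * b k * c2 (r - k)) := by
      rw [← hB, Finset.mul_sum]
      refine Finset.sum_congr rfl fun k hk => ?_
      -- With `s = r - k` the left factor becomes `r * (r + 1) + 2 * p`, the same for every `k`.
      have h := choose_quadratic_identity (2 * p) k (r - k)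
      have hkr : (k : ℤ) + ((r - k : ℕ) : ℤ) = r := by
        have := Finset.mem_range.1 hk
        omega
      rw [hkr] at h
      push_cast at h
      simp only [hc, hc1, hc2]
      linear_combination b k * h
    _ = _ := by
      rw [Finset.sum_add_distrib, Finset.sum_add_distrib, ← hS1, ← hS2,
        ← Finset.sum_add_distrib, ← Finset.sum_add_distrib]
      refine Finset.sum_congr rfl fun k _ => ?_
      rw [show (k : ℤ) - 1 - 1 = k - 2 by ring]
      push_cast
      ring
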